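/- Let $n \ge 2$ be an integer, let $s_i = 5\cdot 2^{n+i} - 3$ for $i \in \mathbb{N} = \{0,1,2,\dots\}$, and let $S = GT(n,2) = \langle \{ s_i : i \in \mathbb{N}\}\rangle$ be the submonoid of $(\mathbb{N},+)$ generated by the $s_i$. Let $F(S)$ be the Frobenius number of $S$, i.e. the greatest natural number not in $S$, and let $Ap(S,s_0) = \{ s \in S : s - s_0 \notin S\}$ be the Apéry set of $S$ with respect to $s_0 = 5\cdot 2^n - 3$. If $n \ge 3$, then $$\max Ap(S,s_0) = 2s_{n-2} + s_{n-1} + s_{n+2} \quad\text{and}\quad F(S) = 25\cdot 2^{2n} - 5\cdot 2^n - 9 .$$ If $n = 2$, then $$\max Ap(S,s_0) = s_1 + s_4 \quad\text{and}\quad F(S) = 337 .$$ -/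

import Mathlib

/-- The generator `s_i = (2^k + 1) * 2^(n+i) - (2^k - 1)` of the generalized Thabit numerical
semigroup; the natural-number subtractions are exact, since `2^k - 1 < 2^k + 1`. -/
def thabitGen (n k i : ℕ) : ℕ := (2 ^ k + 1) * 2 ^ (n + i) - (2 ^ k - 1)

/-- `GT(n, k)`: the submonoid of `(ℕ, +)` generated by all the `s_i`, `i ∈ ℕ`. -/
def GT (n k : ℕ) : AddSubmonoid ℕ :=
  AddSubmonoid.closure (Set.range (thabitGen n k))

/-- The Apéry set `{s ∈ S | s - x ∉ S}`, the difference being taken in `ℤ`: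
no `t ∈ S` satisfies `t = s - x`. -/
def aperySet (S : AddSubmonoid ℕ) (x : ℕ) : Set ℕ :=
  {s | s ∈ S ∧ ∀ t ∈ S, (t : ℤ) ≠ (s : ℤ) - (x : ℤ)}

/-! The generators satisfy `s_{i+1} = 2 s_i + d` with `d = 2 ^ k - 1`, so
`s_i = 2 ^ i s_0 + (2 ^ i - 1) d`, and a sum of `l` generators whose powers `2 ^ i` add up to `t`
equals `t s_0 + (t - l) d`. The number `t - l` takes every value from `0` to `t` minus the binary
digit sum of `t`, which by Legendre's formula is the exponent of `2` in `t!`. Hence `S` consists of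
the numbers `t s_0 + j d` with `j ≤ v₂(t!)`.

As `d` is coprime to `s_0`, every residue class modulo `s_0` contains exactly one `j d` with
`j < s_0`. The class of `(s_0 - 1) d` is the last to be reached: if `t` is the largest number with
`v₂(t!) < s_0 - 1`, the Frobenius number is `t s_0 + (s_0 - 1) d`. For `k = 2` this `t` is
`5 * 2 ^ n - 1` when `n ≥ 3`, because `v₂((5 * 2 ^ n)!) = s_0 + 1` drops by `n` when `5 * 2 ^ n` is
replaced by its predecessor, and it is `17` when `n = 2`. -/

open Finset (range)
open scoped Nat

section Factorial

variable (p : ℕ) [Fact p.Prime]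

theorem padicValNat_factorial_mono : Monotone fun t ↦ padicValNat p t ! := fun _ b hab ↦
  (padicValNat_dvd_iff_le b.factorial_ne_zero).mp
    (pow_padicValNat_dvd.trans (Nat.factorial_dvd_factorial hab))

theorem padicValNat_factorial_add_le (a b : ℕ) :
    padicValNat p a ! + padicValNat p b ! ≤ padicValNat p (a + b)! := by
  rw [← padicValNat.mul a.factorial_ne_zero b.factorial_ne_zero]
  exact (padicValNat_dvd_iff_le (a + b).factorial_ne_zero).mp
    (pow_padicValNat_dvd.trans (Nat.factorial_mul_factorial_dvd_factorial_add a b))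

theorem padicValNat_factorial_eq_div_add (t : ℕ) :
    padicValNat p t ! = padicValNat p (t / p)! + t / p := by
  rw [← padicValNat_mul_div_factorial, padicValNat_factorial_mul]

theorem padicValNat_factorial_pow_mul (n b : ℕ) :
    padicValNat p (p ^ n * b)! = padicValNat p b ! + (∑ i ∈ range n, p ^ i) * b := by
  induction n with
  | zero => simp
  | succ n ih =>
    rw [pow_succ', mul_assoc, padicValNat_factorial_mul, ih, Finset.sum_range_succ]
    ring

end Factorial

section AffineRecurrence

variable {M : Type*} [AddCommMonoid M] {p : ℕ} {s : ℕ → M} {d : M}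

theorem eq_pow_nsmul_add_of_succ_eq (hs : ∀ i, s (i + 1) = p • s i + d) (i : ℕ) :
    s i = p ^ i • s 0 + (∑ j ∈ range i, p ^ j) • d := by
  induction i with
  | zero => simp
  | succ i ih =>
    rw [hs, ih, geom_sum_succ, pow_succ']
    module

theorem nsmul_add_nsmul_mem_closure_range [Fact p.Prime] (hs : ∀ i, s (i + 1) = p • s i + d)
    (i t : ℕ) {j : ℕ} (hj : j ≤ padicValNat p t !) :
    t • s i + j • d ∈ AddSubmonoid.closure (Set.range s) := by
  have nsmul_mem (a b : ℕ) : a • s b ∈ AddSubmonoid.closure (Set.range s) :=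
    AddSubmonoid.nsmul_mem _ (AddSubmonoid.subset_closure (Set.mem_range_self b)) a
  induction t using Nat.strong_induction_on generalizing i j with
  | _ t ih =>
    obtain rfl | ht := t.eq_zero_or_pos
    · obtain rfl : j = 0 := by simpa using hj
      simp
    rw [padicValNat_factorial_eq_div_add] at hj
    -- Trading `p` copies of `s i` for one `s (i + 1)` adds one `d`; at most `t / p` trades are
    -- possible at level `i`, and the remaining ones take place among the new `s (i + 1)`.
    obtain h | h := le_total (t / p) j
    · obtain ⟨k, rfl⟩ := Nat.exists_eq_add_of_le h
      have trade_all : t • s i + (t / p + k) • d =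
          (t % p) • s i + ((t / p) • s (i + 1) + k • d) := by
        nth_rw 1 [← Nat.mod_add_div t p]
        rw [hs]
        module
      rw [trade_all]
      exact add_mem (nsmul_mem _ i)
        (ih (t / p) (Nat.div_lt_self ht (Fact.out : p.Prime).one_lt) (i + 1) (by lia))
    · obtain ⟨k, rfl⟩ := Nat.exists_eq_add_of_le
        ((Nat.mul_le_mul_left p h).trans (Nat.mul_div_le t p))
      have trade_some : (p * j + k) • s i + j • d = k • s i + j • s (i + 1) := by
        rw [hs]
        module
      rw [trade_some]
      exact add_mem (nsmul_mem k i) (nsmul_mem j (i + 1))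

theorem mem_closure_range_iff_of_succ_eq [Fact p.Prime] (hs : ∀ i, s (i + 1) = p • s i + d)
    {x : M} : x ∈ AddSubmonoid.closure (Set.range s) ↔
      ∃ t j, j ≤ padicValNat p t ! ∧ x = t • s 0 + j • d := by
  constructor
  · intro hx
    induction hx using AddSubmonoid.closure_induction with
    | mem x hx =>
      obtain ⟨i, rfl⟩ := hx
      have geom_sum_le : ∑ j ∈ range i, p ^ j ≤ padicValNat p (p ^ i)! := by
        simpa using (padicValNat_factorial_pow_mul p i 1).ge
      exact ⟨p ^ i, _, geom_sum_le, eq_pow_nsmul_add_of_succ_eq hs i⟩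
    | zero => exact ⟨0, 0, Nat.zero_le _, by simp⟩
    | add x y _ _ hx hy =>
      obtain ⟨t, j, hj, rfl⟩ := hx
      obtain ⟨u, k, hk, rfl⟩ := hy
      exact ⟨t + u, j + k, (add_le_add hj hk).trans (padicValNat_factorial_add_le p t u), by module⟩
  · rintro ⟨t, j, hj, rfl⟩
    exact nsmul_add_nsmul_mem_closure_range hs 0 t hj

end AffineRecurrence

theorem exists_add_mul_of_coprime_of_lt {m d t x : ℕ} (hm : m ≠ 0) (hmd : d.Coprime m)
    (hx : t * m + d * (m - 1) < x) : ∃ u j, t < u ∧ j < m ∧ x = u * m + d * j := by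
  obtain ⟨j, hj, hjx⟩ := Nat.exists_mul_mod_eq_of_coprime x hmd hm
  have hle : d * j ≤ d * (m - 1) := Nat.mul_le_mul_left d (by lia)
  obtain ⟨u, hu⟩ := (Nat.modEq_iff_dvd' (by lia)).mp hjx
  refine ⟨u, j, ?_, hj, by lia⟩
  exact Nat.lt_of_mul_lt_mul_right (a := m) (by lia)

theorem le_of_mul_add_mul_eq {m d t u j : ℕ} (hm : m ≠ 0) (hmd : d.Coprime m)
    (h : t * m + d * (m - 1) = u * m + d * j) : u ≤ t ∧ m - 1 ≤ j := by
  have hmod : d * (m - 1) ≡ d * j [MOD m] := by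
    simpa [Nat.ModEq] using congrArg (· % m) h
  have hj : m - 1 ≤ j := by
    have hcancel : (m - 1) % m = j % m := hmod.cancel_left_of_coprime hmd.symm
    rw [Nat.mod_eq_of_lt (by lia)] at hcancel
    exact hcancel.le.trans (Nat.mod_le j m)
  have hle : d * (m - 1) ≤ d * j := Nat.mul_le_mul_left d hj
  exact ⟨Nat.le_of_mul_le_mul_right (by lia) (Nat.pos_of_ne_zero hm), hj⟩

theorem frobeniusNumber_range_of_succ_eq {p : ℕ} [Fact p.Prime] {s : ℕ → ℕ} {d t : ℕ}
    (hs : ∀ i, s (i + 1) = p * s i + d) (hd : d.Coprime (s 0))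
    (ht : padicValNat p t ! + 1 < s 0) (ht' : s 0 ≤ padicValNat p (t + 1)! + 1) :
    FrobeniusNumber (t * s 0 + d * (s 0 - 1)) (Set.range s) := by
  have mem_iff (x : ℕ) : x ∈ AddSubmonoid.closure (Set.range s) ↔
      ∃ u j, j ≤ padicValNat p u ! ∧ x = u * s 0 + d * j := by
    simpa [mul_comm d] using mem_closure_range_iff_of_succ_eq (x := x) hs
  refine frobeniusNumber_iff.mpr ⟨fun hmem ↦ ?_, fun x hx ↦ ?_⟩
  · obtain ⟨u, j, hj, h⟩ := (mem_iff _).mp hmem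
    obtain ⟨hut, hmj⟩ := le_of_mul_add_mul_eq (by lia) hd h
    have hval : padicValNat p u ! ≤ padicValNat p t ! := padicValNat_factorial_mono p hut
    lia
  · obtain ⟨u, j, htu, hj, h⟩ := exists_add_mul_of_coprime_of_lt (by lia) hd hx
    have hval : padicValNat p (t + 1)! ≤ padicValNat p u ! := padicValNat_factorial_mono p htu
    exact (mem_iff x).mpr ⟨u, j, by lia, h⟩

theorem isGreatest_aperySet_add {S : AddSubmonoid ℕ} {x f : ℕ} (hx : 0 < x)
    (hf : IsGreatest {k | k ∉ S} f) : IsGreatest (aperySet S x) (f + x) := by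
  have mem_of_lt {y : ℕ} (hy : f < y) : y ∈ S := by
    by_contra h
    exact hy.not_ge (hf.2 h)
  refine ⟨⟨mem_of_lt (by lia), fun t ht h ↦ ?_⟩, fun y hy ↦ ?_⟩
  · obtain rfl : t = f := by lia
    exact hf.1 ht
  · by_contra! hlt
    exact hy.2 (y - x) (mem_of_lt (by lia)) (by lia)

section ThabitGen

variable (n k i : ℕ)

theorem thabitGen_add : thabitGen n k i + (2 ^ k - 1) = (2 ^ k + 1) * 2 ^ (n + i) :=
  Nat.sub_add_cancel <| (show 2 ^ k - 1 ≤ 2 ^ k + 1 by lia).trans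
    (Nat.le_mul_of_pos_right _ (by positivity))

theorem thabitGen_pos : 0 < thabitGen n k i := by
  have hadd := thabitGen_add n k i
  have hle : 2 ^ k + 1 ≤ (2 ^ k + 1) * 2 ^ (n + i) := Nat.le_mul_of_pos_right _ (by positivity)
  lia

theorem thabitGen_succ : thabitGen n k (i + 1) = 2 * thabitGen n k i + (2 ^ k - 1) := by
  have hi := thabitGen_add n k i
  have hsucc := thabitGen_add n k (i + 1)
  rw [← add_assoc, pow_succ, ← mul_assoc] at hsucc
  lia

variable {k} in
theorem coprime_thabitGen (hk : k ≠ 0) : (2 ^ k - 1).Coprime (thabitGen n k i) := by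
  have hodd : (2 ^ k - 1).Coprime 2 :=
    (Nat.Even.sub_odd Nat.one_le_two_pow (by simp [hk, Nat.even_pow]) odd_one).coprime_two_right
  have hsub : 2 ^ k + 1 = 2 ^ k - 1 + 2 := by
    have := Nat.one_le_two_pow (n := k)
    lia
  rw [← Nat.coprime_add_self_right, thabitGen_add]
  refine Nat.Coprime.mul_right ?_ (hodd.pow_right _)
  rwa [hsub, Nat.coprime_self_add_right]

theorem thabitGen_two_add_three : thabitGen n 2 i + 3 = 5 * 2 ^ (n + i) :=
  thabitGen_add n 2 i

end ThabitGen

theorem padicValNat_two_factorial_five_mul_two_pow (n : ℕ) :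
    padicValNat 2 (5 * 2 ^ n)! + 2 = 5 * 2 ^ n := by
  have hfive : padicValNat 2 5! = 3 := by
    simpa using sub_one_mul_padicValNat_factorial (p := 2) 5
  have hgeom : (∑ i ∈ range n, 2 ^ i) + 1 = 2 ^ n := by
    simpa using geom_sum_mul_add (1 : ℕ) n
  rw [mul_comm, padicValNat_factorial_pow_mul, hfive]
  lia

theorem padicValNat_two_factorial_five_mul_two_pow_sub_one (n : ℕ) :
    padicValNat 2 (5 * 2 ^ n - 1)! + n + 2 = 5 * 2 ^ n := by
  have hval : padicValNat 2 (5 * 2 ^ n) = n := by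
    rw [padicValNat.mul (by norm_num) (by positivity), padicValNat.prime_pow,
      padicValNat.eq_zero_of_not_dvd (by norm_num), zero_add]
  have hfact := padicValNat_two_factorial_five_mul_two_pow n
  rw [← Nat.mul_factorial_pred (by positivity), padicValNat.mul (by positivity)
    (Nat.factorial_ne_zero _), hval] at hfact
  lia

theorem frobeniusNumber_range_thabitGen_two {n : ℕ} (hn : 3 ≤ n) :
    FrobeniusNumber (25 * 2 ^ (2 * n) - 5 * 2 ^ n - 9) (Set.range (thabitGen n 2)) := by
  have hs₀ : thabitGen n 2 0 + 3 = 5 * 2 ^ n := thabitGen_two_add_three n 0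
  have hpos := thabitGen_pos n 2 0
  have hval := padicValNat_two_factorial_five_mul_two_pow n
  have hval_pred := padicValNat_two_factorial_five_mul_two_pow_sub_one n
  have hsucc : 5 * 2 ^ n - 1 + 1 = 5 * 2 ^ n := by lia
  convert frobeniusNumber_range_of_succ_eq (p := 2) (t := 5 * 2 ^ n - 1) (thabitGen_succ n 2)
    (coprime_thabitGen n 0 two_ne_zero) (by lia) (by rw [hsucc]; lia) using 1
  have hsq : 25 * 2 ^ (2 * n) = (thabitGen n 2 0 + 3) ^ 2 := by
    rw [hs₀]
    ring
  obtain ⟨m, hm⟩ := Nat.exists_eq_succ_of_ne_zero hpos.ne'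
  rw [hsq, ← hs₀, hm]
  lia

theorem frobeniusNumber_range_thabitGen_two_two :
    FrobeniusNumber 337 (Set.range (thabitGen 2 2)) := by
  have hval : padicValNat 2 17! = 15 := by
    simpa using sub_one_mul_padicValNat_factorial (p := 2) 17
  have hval_succ : padicValNat 2 18! = 16 := by
    simpa using sub_one_mul_padicValNat_factorial (p := 2) 18
  exact frobeniusNumber_range_of_succ_eq (p := 2) (t := 17) (thabitGen_succ 2 2)
    (coprime_thabitGen 2 0 two_ne_zero) (by rw [hval]; decide) (by rw [hval_succ]; decide)

theorem two_mul_thabitGen_add_add_twelve {n : ℕ} (hn : 2 ≤ n) :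
    2 * thabitGen n 2 (n - 2) + thabitGen n 2 (n - 1) + thabitGen n 2 (n + 2) + 12 =
      25 * 2 ^ (2 * n) := by
  obtain ⟨m, rfl⟩ := Nat.exists_eq_add_of_le' hn
  calc
    _ = 2 * (thabitGen (m + 2) 2 m + 3) + (thabitGen (m + 2) 2 (m + 1) + 3) +
        (thabitGen (m + 2) 2 (m + 4) + 3) := by
      simp only [Nat.add_sub_cancel, show m + 2 - 1 = m + 1 by lia]
      ring
    _ = 25 * 2 ^ (2 * (m + 2)) := by
      simp only [thabitGen_two_add_three]
      ring

theorem mainTheorem5 (n : ℕ) (hn : 2 ≤ n) :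
    (3 ≤ n →
      FrobeniusNumber (25 * 2 ^ (2 * n) - 5 * 2 ^ n - 9)
          (Set.range fun i : ℕ => 5 * 2 ^ (n + i) - 3) ∧
        IsGreatest (aperySet (GT n 2) (thabitGen n 2 0))
          (2 * thabitGen n 2 (n - 2) + thabitGen n 2 (n - 1) + thabitGen n 2 (n + 2))) ∧
    (n = 2 →
      FrobeniusNumber 337 (Set.range fun i : ℕ => 5 * 2 ^ (n + i) - 3) ∧
        IsGreatest (aperySet (GT n 2) (thabitGen n 2 0))
          (thabitGen n 2 1 + thabitGen n 2 4)) := by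
  refine ⟨fun hn₃ ↦ ?_, ?_⟩
  · have hF := frobeniusNumber_range_thabitGen_two hn₃
    refine ⟨hF, ?_⟩
    have hAp : IsGreatest (aperySet (GT n 2) (thabitGen n 2 0)) _ :=
      isGreatest_aperySet_add (thabitGen_pos n 2 0) hF
    convert hAp using 1
    have hs₀ : thabitGen n 2 0 + 3 = 5 * 2 ^ n := thabitGen_two_add_three n 0
    have hsum := two_mul_thabitGen_add_add_twelve hn
    have hle : 2 ^ n ≤ 2 ^ (2 * n) := Nat.pow_le_pow_right two_pos (by lia)
    lia
  · rintro rfl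
    have hF := frobeniusNumber_range_thabitGen_two_two
    exact ⟨hF, isGreatest_aperySet_add (thabitGen_pos 2 2 0) hF⟩
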